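/- Call two sets in the plane homothetic if one is obtained from the other by scaling with a positive factor and translating. A planar convex body is a compact convex subset of $\mathbb{R}^2$ with nonempty interior; a convex polygon is the convex hull of finitely many points of $\mathbb{R}^2$ that has nonempty interior. A family of subsets of the plane is an arrangement of pseudodisks if every member is a closed region bounded by a simple closed (Jordan) curve, i.e. the curve together with its inside, and for any two members $A,B$ both differences $A\setminus B$ and $B\setminus A$ are arc-connected (the empty set counts as arc-connected). An intersection representation of a graph $G$ is a family $(R_v)_{v\in V(G)}$ of pairwise distinct subsets of $\mathbb{R}^2$ such that distinct vertices $u,v$ are adjacent if and only if $R_u\cap R_v\neq\emptyset$. The graph $G$ is a $P_{hom}$ graph if it has an intersection representation by sets homothetic to $P$, and a pseudodisk intersection graph if it has an intersection representation that is an arrangement of pseudodisks. (1) Let $(A_i)_{i\in I}$ be a family of pairwise homothetic planar convex bodies in general position, i.e. for $i\ne j$ the boundaries $\partial A_i$ and $\partial A_j$ have only finitely many common points. Then $(A_i)_{i\in I}$ is an arrangement of pseudodisks; moreover $|\partial A_i\cap\partial A_j|\le 2$ for all $i\neq j$. (2) For every convex polygon $P$, every $P_{hom}$ graph is a pseudodisk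 intersection graph. -/

import Mathlib

namespace PseudodiskPaper

/-- The Euclidean plane. -/
abbrev Plane : Type := EuclideanSpace ℝ (Fin 2)

/-- `B` is obtained from `A` by scaling (with a positive factor) and translating. -/
def Homothetic (A B : Set Plane) : Prop :=
  ∃ r : ℝ, 0 < r ∧ ∃ c : Plane, B = (fun x => r • x + c) '' A

/-- A planar convex body: a compact convex set with nonempty interior. -/
def IsPlanarConvexBody (A : Set Plane) : Prop :=
  Convex ℝ A ∧ IsCompact A ∧ (interior A).Nonempty

/-- A (nondegenerate, closed) convex polygon: the convex hull of finitely many points, with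
nonempty interior. -/
def IsConvexPolygon (P : Set Plane) : Prop :=
  (∃ S : Set Plane, S.Finite ∧ P = convexHull ℝ S) ∧ (interior P).Nonempty

/-- A simple closed (Jordan) curve: the image of the circle under a continuous injective map. -/
def IsJordanCurve (J : Set Plane) : Prop :=
  ∃ γ : Circle → Plane, Continuous γ ∧ Function.Injective γ ∧ Set.range γ = J

/-- The inside of `J`: the union of the bounded connected components of the complement of `J`. -/
def inside (J : Set Plane) : Set Plane :=
  {x | x ∈ Jᶜ ∧ Bornology.IsBounded (connectedComponentIn Jᶜ x)}

/-- A closed planar region bounded by a simple closed curve: the curve with its inside. -/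
def IsClosedJordanRegion (A : Set Plane) : Prop :=
  ∃ J : Set Plane, IsJordanCurve J ∧ A = J ∪ inside J

/-- Any two points of `S` are joined by a path inside `S`. The empty set has this property
(one region may contain the other). -/
def IsArcConnected (S : Set Plane) : Prop :=
  ∀ x ∈ S, ∀ y ∈ S, JoinedIn S x y

/-- The pseudodisk relation: both differences are arc-connected. -/
def PseudodiskRelation (A B : Set Plane) : Prop :=
  IsArcConnected (A \ B) ∧ IsArcConnected (B \ A)

/-- A family of closed regions bounded by simple closed curves that are pairwise in the
pseudodisk relation. -/
def IsPseudodiskArrangement {ι : Type*} (A : ι → Set Plane) : Prop :=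
  (∀ i, IsClosedJordanRegion (A i)) ∧ ∀ i j, i ≠ j → PseudodiskRelation (A i) (A j)

/-- No two members of the family have infinitely many common boundary points. -/
def InGeneralPosition {ι : Type*} (A : ι → Set Plane) : Prop :=
  ∀ i j, i ≠ j → (frontier (A i) ∩ frontier (A j)).Finite

/-- The intersection graph of a family of sets. -/
def intersectionGraph {V : Type*} (R : V → Set Plane) : SimpleGraph V where
  Adj u v := u ≠ v ∧ (R u ∩ R v).Nonempty
  symm := ⟨fun u v h => ⟨h.1.symm, by rw [Set.inter_comm]; exact h.2⟩⟩
  loopless := ⟨fun _ h => h.1 rfl⟩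

/-- `R` is an intersection representation of `G`: the vertices are in one-to-one correspondence
with the sets, and distinct vertices are adjacent iff their sets meet. -/
def IsIntersectionRepresentation {V : Type*} (G : SimpleGraph V) (R : V → Set Plane) : Prop :=
  Function.Injective R ∧ intersectionGraph R = G

/-- The class of intersection graphs of sets homothetic to `P`. -/
def IsHomGraph {V : Type*} (P : Set Plane) (G : SimpleGraph V) : Prop :=
  ∃ R : V → Set Plane, IsIntersectionRepresentation G R ∧ ∀ v, Homothetic P (R v)

/-- The class of pseudodisk intersection graphs. -/
def IsPseudodiskGraph {V : Type*} (G : SimpleGraph V) : Prop :=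
  ∃ R : V → Set Plane, IsIntersectionRepresentation G R ∧ IsPseudodiskArrangement R

end PseudodiskPaper

/-! For convex bodies, `A \ B` is the union of the caps cut off `A` in the directions `f` where the
support functions satisfy `h_B f < h_A f`. Caps in nearby directions overlap, so it suffices that
these directions form a connected set (`joinedIn_diff_of_isPreconnected`). For homothetic `B` this
holds because `h_B = r h_A + ⟨·, c⟩` and `h_A` is sublinear (`isPreconnected_supportFun_lt`).

For the bound on common boundary points, write `A = s B + e`. Three common points and their images
under this map all lie on the boundary of `A`. Supporting lines then give either infinitely many
common boundary points or `s = 1` and `e = 0`, so `A = B`; both contradict finiteness. -/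

namespace PseudodiskPaper

open Set Topology Bornology
open scoped Pointwise

/-! ### Support functions and connectedness of differences -/

section SupportFunction

variable {E : Type*} [NormedAddCommGroup E] [InnerProductSpace ℝ E]

/-- The support function of a set. -/
noncomputable def supportFun (A : Set E) (f : E) : ℝ := sSup ((fun x => inner ℝ f x) '' A)

theorem isCompact_inner_image {A : Set E} (hA : IsCompact A) (f : E) :
    IsCompact ((fun x => inner ℝ f x) '' A) :=
  hA.image (by fun_prop)

theorem inner_le_supportFun {A : Set E} (hA : IsCompact A) (f : E) {x : E} (hx : x ∈ A) :
    inner ℝ f x ≤ supportFun A f :=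
  le_csSup (isCompact_inner_image hA f).bddAbove (mem_image_of_mem _ hx)

theorem exists_inner_eq_supportFun {A : Set E} (hA : IsCompact A) (hne : A.Nonempty) (f : E) :
    ∃ x ∈ A, inner ℝ f x = supportFun A f :=
  (isCompact_inner_image hA f).sSup_mem (hne.image _)

theorem supportFun_zero {A : Set E} (hA : IsCompact A) (hne : A.Nonempty) :
    supportFun A 0 = 0 := by
  obtain ⟨x, -, h⟩ := exists_inner_eq_supportFun hA hne 0
  simpa using h.symm

theorem supportFun_add_le {A : Set E} (hA : IsCompact A) (hne : A.Nonempty) (f g : E) :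
    supportFun A (f + g) ≤ supportFun A f + supportFun A g := by
  obtain ⟨x, hx, h⟩ := exists_inner_eq_supportFun hA hne (f + g)
  rw [← h, inner_add_left]
  exact add_le_add (inner_le_supportFun hA f hx) (inner_le_supportFun hA g hx)

theorem supportFun_smul {A : Set E} (hA : IsCompact A) (hne : A.Nonempty) {t : ℝ} (ht : 0 ≤ t)
    (f : E) : supportFun A (t • f) = t * supportFun A f := by
  obtain ⟨x, hx, h⟩ := exists_inner_eq_supportFun hA hne (t • f)
  obtain ⟨y, hy, h'⟩ := exists_inner_eq_supportFun hA hne f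
  apply le_antisymm
  · rw [← h, real_inner_smul_left]
    exact mul_le_mul_of_nonneg_left (inner_le_supportFun hA f hx) ht
  · rw [← h', ← real_inner_smul_left]
    exact inner_le_supportFun hA _ hy

theorem supportFun_homothety {A : Set E} (hA : IsCompact A) (hne : A.Nonempty) {r : ℝ}
    (hr : 0 ≤ r) (c f : E) :
    supportFun ((fun x => r • x + c) '' A) f = r * supportFun A f + inner ℝ f c := by
  have hB : IsCompact ((fun x => r • x + c) '' A) := hA.image (by fun_prop)
  obtain ⟨y, hy, h⟩ := exists_inner_eq_supportFun hB (hne.image _) f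
  obtain ⟨x, hx, h'⟩ := exists_inner_eq_supportFun hA hne f
  apply le_antisymm
  · obtain ⟨a, ha, rfl⟩ := hy
    rw [← h, inner_add_right, real_inner_smul_right]
    gcongr
    exact inner_le_supportFun hA f ha
  · rw [← h', ← real_inner_smul_right, ← inner_add_right]
    exact inner_le_supportFun hB f (mem_image_of_mem _ hx)

theorem supportFun_add_supportFun_neg_pos {A : Set E} (hA : IsCompact A)
    (hint : (interior A).Nonempty) {f : E} (hf : f ≠ 0) :
    0 < supportFun A f + supportFun A (-f) := by
  obtain ⟨x, hx⟩ := hint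
  have hcont : Continuous fun t : ℝ => x + t • f := by fun_prop
  have hmem : ∀ᶠ t in 𝓝[>] (0 : ℝ), x + t • f ∈ A := by
    refine nhdsWithin_le_nhds (hcont.continuousAt.eventually_mem ?_)
    simpa using mem_interior_iff_mem_nhds.1 hx
  obtain ⟨t, htA, ht⟩ := (hmem.and self_mem_nhdsWithin).exists
  have h1 := inner_le_supportFun hA f htA
  have h2 := inner_le_supportFun hA (-f) (interior_subset hx)
  rw [inner_add_right, real_inner_smul_right] at h1
  rw [inner_neg_left] at h2
  have := mul_pos (mem_Ioi.1 ht) (real_inner_self_pos.2 hf)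
  linarith

/-- If the directions in which `A` reaches strictly further than `B` form a preconnected set, then
`A \ B` is arc-connected: it is the union of the convex caps cut off `A` in these directions. -/
theorem joinedIn_diff_of_isPreconnected [CompleteSpace E] {A B : Set E} (hA : IsCompact A)
    (hAc : Convex ℝ A) (hAne : A.Nonempty) (hB : IsCompact B) (hBc : Convex ℝ B)
    (hBne : B.Nonempty) (hU : IsPreconnected {f : E | supportFun B f < supportFun A f})
    {x y : E} (hx : x ∈ A \ B) (hy : y ∈ A \ B) : JoinedIn (A \ B) x y := by
  set C : E → Set E := fun f => {z ∈ A | ∀ b ∈ B, inner ℝ f b < inner ℝ f z}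
  have hjoin : ∀ f, ∀ z ∈ C f, ∀ w ∈ C f, JoinedIn (A \ B) z w := by
    intro f z hz w hw
    refine JoinedIn.of_segment_subset fun v hv => ⟨hAc.segment_subset hz.1 hw.1 hv, fun hvB => ?_⟩
    obtain ⟨a, b, ha, hb, hab, rfl⟩ := hv
    have h1 := hz.2 _ hvB
    have h2 := hw.2 _ hvB
    rw [inner_add_right, real_inner_smul_right, real_inner_smul_right] at h1 h2
    obtain rfl : a = 1 - b := by linarith
    rcases le_total (inner ℝ f z) (inner ℝ f w) with h | h
    · nlinarith [mul_nonneg hb (sub_nonneg.2 h)]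
    · nlinarith [mul_nonneg ha (sub_nonneg.2 h)]
  have hne : ∀ f, supportFun B f < supportFun A f → (C f).Nonempty := by
    intro f hf
    obtain ⟨z, hz, h⟩ := exists_inner_eq_supportFun hA hAne f
    exact ⟨z, hz, fun b hb => ((inner_le_supportFun hB f hb).trans_lt hf).trans_eq h.symm⟩
  -- The caps cover `A \ B`: a hyperplane strictly separating `z` from `B` gives the direction.
  have hsep : ∀ z ∈ A \ B, ∃ f, supportFun B f < supportFun A f ∧ z ∈ C f := by
    intro z hz
    obtain ⟨φ, u, hu, hφ⟩ := geometric_hahn_banach_closed_point hBc hB.isClosed hz.2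
    have hφ' : ∀ v, inner ℝ ((InnerProductSpace.toDual ℝ E).symm φ) v = φ v := fun v => by simp
    have hzC : z ∈ C ((InnerProductSpace.toDual ℝ E).symm φ) :=
      ⟨hz.1, fun b hb => by rw [hφ', hφ']; exact (hu b hb).trans hφ⟩
    refine ⟨_, ?_, hzC⟩
    obtain ⟨b, hb, h⟩ := exists_inner_eq_supportFun hB hBne ((InnerProductSpace.toDual ℝ E).symm φ)
    rw [← h]
    exact (hzC.2 b hb).trans_le (inner_le_supportFun hA _ hz.1)
  obtain ⟨f, hf, hxf⟩ := hsep x hx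
  obtain ⟨g, hg, hyg⟩ := hsep y hy
  refine hU.induction₂ (fun f g => ∀ z ∈ C f, ∀ w ∈ C g, JoinedIn (A \ B) z w) ?_ ?_ ?_
    hf hg x hxf y hyg
  · intro f hf
    obtain ⟨z, hz⟩ := hne f hf
    -- Compactness of `B` keeps `z` in the cap of every nearby direction, so neighbouring caps meet.
    have hev : ∀ᶠ g in 𝓝 f, ∀ b ∈ B, inner ℝ g b < inner ℝ g z := by
      refine hB.eventually_forall_of_forall_eventually fun b hb => ?_
      refine IsOpen.mem_nhds (s := {p : E × E | inner ℝ p.1 p.2 < inner ℝ p.1 z}) ?_ (hz.2 b hb)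
      exact isOpen_lt (by fun_prop) (by fun_prop)
    filter_upwards [nhdsWithin_le_nhds hev] with g hg w hw v hv
    exact (hjoin f w hw z hz).trans (hjoin g z ⟨hz.1, hg⟩ v hv)
  · intro f g k _ hg _ hfg hgk z hz w hw
    obtain ⟨v, hv⟩ := hne g hg
    exact (hfg z hz v hv).trans (hgk v hv w hw)
  · intro f g _ _ h z hz w hw
    exact (h w hw z hz).symm

/-- For `1 ≤ r` the condition reads `(r - 1) h_A f + ⟨f, c⟩ < 0`, a strict sublevel set of a convex
function. For `r < 1` the complement `K` is a convex cone. If `K = {0}`, the dimension makes the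
punctured space connected. Otherwise take `k ≠ 0` in `K`: the set is star-shaped about `-k`, since a
point `-a k + b g` in `K` would force `b g ∈ K` after adding `a k`. -/
theorem isPreconnected_supportFun_lt (hE : 1 < Module.rank ℝ E) {A : Set E} (hA : IsCompact A)
    (hint : (interior A).Nonempty) {r : ℝ} (hr : 0 ≤ r) (c : E) :
    IsPreconnected {f : E | supportFun ((fun x => r • x + c) '' A) f < supportFun A f} := by
  have hne : A.Nonempty := hint.mono interior_subset
  simp only [supportFun_homothety hA hne hr]
  rcases le_or_gt 1 r with h1 | h1
  · refine Convex.isPreconnected fun f hf g hg a b ha hb hab => ?_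
    simp only [mem_ofPred_eq] at hf hg ⊢
    have h2 := supportFun_add_le hA hne (a • f) (b • g)
    rw [supportFun_smul hA hne ha, supportFun_smul hA hne hb] at h2
    rw [inner_add_left, real_inner_smul_left, real_inner_smul_left]
    have h3 := mul_le_mul_of_nonneg_left h2 (sub_nonneg.2 h1)
    obtain rfl : a = 1 - b := by linarith
    rcases hb.eq_or_lt with rfl | hb
    · nlinarith
    · nlinarith [mul_pos hb (sub_pos.2 hg), mul_nonneg ha (sub_pos.2 hf).le]
  · by_cases hK : ∀ f : E, f ≠ 0 → r * supportFun A f + inner ℝ f c < supportFun A f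
    · have : {f : E | r * supportFun A f + inner ℝ f c < supportFun A f} = {0}ᶜ := by
        ext f
        refine ⟨?_, hK f⟩
        rintro h rfl
        simp [supportFun_zero hA hne] at h
      rw [this]
      exact (isConnected_compl_singleton_of_one_lt_rank hE 0).isPreconnected
    · push Not at hK
      obtain ⟨k, hk0, hk⟩ := hK
      have hpos := mul_pos (sub_pos.2 h1) (supportFun_add_supportFun_neg_pos hA hint hk0)
      have hmem : -k ∈ {f : E | r * supportFun A f + inner ℝ f c < supportFun A f} := by
        simp only [mem_ofPred_eq, inner_neg_left]
        nlinarith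
      refine (StarConvex.isPathConnected (a := -k) ?_ hmem).isConnected.isPreconnected
      intro g hg a b ha hb hab
      simp only [mem_ofPred_eq] at hg ⊢
      rcases hb.eq_or_lt with rfl | hb
      · obtain rfl : a = 1 := by linarith
        simpa using hmem
      · have h2 := supportFun_add_le hA hne (a • -k + b • g) (a • k)
        rw [show a • -k + b • g + a • k = b • g by module, supportFun_smul hA hne ha,
          supportFun_smul hA hne hb.le] at h2
        rw [inner_add_left, real_inner_smul_left, real_inner_smul_left, inner_neg_left]
        have h3 := mul_le_mul_of_nonneg_left h2 (sub_pos.2 h1).le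
        nlinarith [mul_pos hb (sub_pos.2 hg), mul_nonneg ha (sub_nonneg.2 hk)]

end SupportFunction

/-! ### Supporting hyperplanes and boundary segments -/

section Frontier

variable {E : Type*} [NormedAddCommGroup E] [NormedSpace ℝ E]

theorem exists_forall_le_of_mem_frontier {A : Set E} (hA : Convex ℝ A)
    (hint : (interior A).Nonempty) {x : E} (hx : x ∈ frontier A) :
    ∃ f : StrongDual ℝ E, (∀ a ∈ A, f a ≤ f x) ∧ ∀ a ∈ interior A, f a < f x := by
  obtain ⟨f, hf⟩ := geometric_hahn_banach_open_point hA.interior isOpen_interior hx.2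
  refine ⟨f, fun a ha => ?_, hf⟩
  -- The interior is dense in `A`, so the weak inequality passes to all of `A`.
  have hcl : a ∈ closure (interior A) := by
    rw [hA.closure_interior_eq_closure_of_nonempty_interior hint]
    exact subset_closure ha
  exact closure_minimal (fun b hb => (hf b hb).le) (isClosed_le f.continuous continuous_const) hcl

theorem segment_subset_frontier {A : Set E} (hA : Convex ℝ A) {f : StrongDual ℝ E} {m : ℝ}
    (hf : ∀ a ∈ interior A, f a < m) {x y : E} (hx : x ∈ A) (hy : y ∈ A) (hfx : f x = m)
    (hfy : f y = m) : segment ℝ x y ⊆ frontier A := by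
  intro z hz
  refine ⟨subset_closure (hA.segment_subset hx hy hz), fun hzi => (hf z hzi).ne ?_⟩
  obtain ⟨a, b, -, -, hab, rfl⟩ := hz
  rw [map_add, map_smul, map_smul, hfx, hfy, smul_eq_mul, smul_eq_mul, ← add_mul, hab, one_mul]

theorem segment_subset_frontier_of_wbtw {A : Set E} (hA : Convex ℝ A)
    (hint : (interior A).Nonempty) {x y z : E} (hx : x ∈ A) (hy : y ∈ frontier A) (hz : z ∈ A)
    (hxy : x ≠ y) (hyz : y ≠ z) (hw : Wbtw ℝ x y z) : segment ℝ x z ⊆ frontier A := by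
  obtain ⟨f, hf, hf'⟩ := exists_forall_le_of_mem_frontier hA hint hy
  obtain ⟨t, ⟨ht0, ht1⟩, rfl⟩ := hw
  have ht0 : 0 < t := ht0.lt_of_ne (by rintro rfl; simp at hxy)
  have ht1 : t < 1 := ht1.lt_of_ne (by rintro rfl; simp at hyz)
  have hfx := hf x hx
  have hfz := hf z hz
  refine segment_subset_frontier hA hf' hx hz ?_ ?_ <;>
  · simp only [AffineMap.lineMap_apply_module, map_add, map_smul, smul_eq_mul] at hfx hfz ⊢
    nlinarith

/-- Two homothetic triangles `x y z` and `x' y' z'` in a convex set, where `x'` is a boundary point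
lying in the cone spanned at `x` by `y` and `z`, with a positive component towards `y`. -/
theorem segment_subset_frontier_of_homothetic_triangles {A : Set E} (hA : Convex ℝ A)
    (hint : (interior A).Nonempty) {x y z x' y' z' : E} (hx : x ∈ A) (hy : y ∈ A)
    (hx' : x' ∈ A) (hy' : y' ∈ A) (hz' : z' ∈ A) (hfr : x' ∈ frontier A)
    {s a b : ℝ} (hs : 0 < s) (hys : y' - x' = s • (y - x)) (hzs : z' - x' = s • (z - x))
    (hd : x' - x = a • (y - x) + b • (z - x)) (ha : 0 < a) (hb : 0 ≤ b) :
    segment ℝ x y ⊆ frontier A ∧ segment ℝ x' y' ⊆ frontier A := by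
  obtain ⟨f, hf, hf'⟩ := exists_forall_le_of_mem_frontier hA hint hfr
  have e1 := congrArg f hys
  have e2 := congrArg f hzs
  have e3 := congrArg f hd
  simp only [map_sub, map_add, map_smul, smul_eq_mul] at e1 e2 e3
  have h1 : f y - f x ≤ 0 := by
    have := hf y' hy'
    by_contra! h
    nlinarith [mul_pos hs h]
  have h2 : f z - f x ≤ 0 := by
    have := hf z' hz'
    by_contra! h
    nlinarith [mul_pos hs h]
  have h3 := hf x hx
  have h4 : f y - f x = 0 := by
    refine le_antisymm h1 ?_
    by_contra! h
    nlinarith [mul_pos ha (neg_pos.2 h), mul_nonneg hb (neg_nonneg.2 h2)]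
  have h5 : f x = f x' := by
    rw [h4] at e3
    nlinarith [mul_nonneg hb (neg_nonneg.2 h2)]
  refine ⟨segment_subset_frontier hA hf' hx hy h5 (by linarith),
    segment_subset_frontier hA hf' hx' hy' rfl ?_⟩
  rw [h4] at e1
  linarith

end Frontier

theorem finrank_plane : Module.finrank ℝ Plane = 2 := by simp

theorem one_lt_rank_plane : 1 < Module.rank ℝ Plane := by
  rw [← Module.finrank_eq_rank, finrank_plane]
  norm_num

/-! ### Convex bodies as closed Jordan regions -/

section Jordan

/-- The unit circle of the plane, parametrised by `Circle`. -/
noncomputable def circleToPlane (z : Circle) : Plane :=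
  Complex.orthonormalBasisOneI.repr (z : ℂ)

theorem continuous_circleToPlane : Continuous circleToPlane :=
  Complex.orthonormalBasisOneI.repr.continuous.comp continuous_subtype_val

theorem injective_circleToPlane : Function.Injective circleToPlane :=
  Complex.orthonormalBasisOneI.repr.injective.comp Subtype.val_injective

theorem range_circleToPlane : range circleToPlane = Metric.sphere 0 1 := by
  ext x
  simp only [mem_range, circleToPlane, mem_sphere_iff_norm, sub_zero]
  constructor
  · rintro ⟨z, rfl⟩
    rw [LinearIsometryEquiv.norm_map, Circle.norm_coe]
  · intro hx
    refine ⟨⟨Complex.orthonormalBasisOneI.repr.symm x, ?_⟩,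
      Complex.orthonormalBasisOneI.repr.apply_symm_apply x⟩
    exact mem_sphere_zero_iff_norm.2 ((LinearIsometryEquiv.norm_map _ _).trans hx)

variable {A : Set Plane}

theorem IsPlanarConvexBody.isJordanCurve_frontier (hA : IsPlanarConvexBody A) :
    IsJordanCurve (frontier A) := by
  obtain ⟨h, -, -, hfr⟩ := exists_homeomorph_image_interior_closure_frontier_eq_unitBall hA.1 hA.2.2
    hA.2.1.isBounded
  refine ⟨h.symm ∘ circleToPlane, h.symm.continuous.comp continuous_circleToPlane,
    h.symm.injective.comp injective_circleToPlane, ?_⟩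
  rw [range_comp, range_circleToPlane, ← hfr, image_image]
  simp

theorem IsPlanarConvexBody.infinite_frontier (hA : IsPlanarConvexBody A) :
    (frontier A).Infinite := by
  obtain ⟨γ, -, hγ, hr⟩ := hA.isJordanCurve_frontier
  rw [← hr]
  have : Infinite (Ioc (-Real.pi) Real.pi) :=
    (Ioc_infinite (by linarith [Real.pi_pos])).to_subtype
  have : Infinite Circle :=
    Infinite.of_injective (fun t : Ioc (-Real.pi) Real.pi => Circle.exp t)
      (Circle.invOn_arg_exp.1.injOn.injective)
  exact infinite_range_of_injective hγ

/-- A point outside a compact convex set lies in an unbounded component of the complement of the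
frontier, because the ray leaving the set avoids it. -/
theorem not_isBounded_connectedComponentIn_compl_frontier (hA : IsPlanarConvexBody A) {x : Plane}
    (hx : x ∉ A) : ¬ IsBounded (connectedComponentIn (frontier A)ᶜ x) := by
  obtain ⟨a, ha⟩ := hA.2.2
  have haA := interior_subset ha
  have hne : x - a ≠ 0 := fun h => hx (by rwa [sub_eq_zero.1 h])
  set R : Set Plane := (fun t : ℝ => x + t • (x - a)) '' Ici 0
  have hRA : R ⊆ (frontier A)ᶜ := by
    rintro _ ⟨t, ht, rfl⟩ hfr
    have ht : 0 ≤ t := ht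
    have hmem := hA.2.1.isClosed.frontier_subset hfr
    refine hx ?_
    have hpos : 0 < 1 + t := by linarith
    -- `x` lies between `a` and the ray point, so it would belong to `A`.
    have hc := hA.1 hmem haA (inv_nonneg.2 hpos.le) (mul_nonneg ht (inv_nonneg.2 hpos.le))
      (by field_simp)
    convert hc using 1
    match_scalars <;> field_simp
    ring
  have hRc : IsPreconnected R :=
    (convex_Ici (0 : ℝ)).isPreconnected.image _ (by fun_prop)
  have hsub := hRc.subset_connectedComponentIn (x := x) ⟨0, self_mem_Ici, by simp⟩ hRA
  intro hb
  obtain ⟨M, hM⟩ := (hb.subset hsub).exists_norm_le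
  have hn : 0 < ‖x - a‖ := norm_pos_iff.2 hne
  have hM0 : 0 ≤ M := (norm_nonneg _).trans (hM _ ⟨0, self_mem_Ici, rfl⟩)
  -- This parameter moves `x` by exactly `M + ‖x‖ + 1`, beyond the ball of radius `M`.
  have ht : (0 : ℝ) ≤ (M + ‖x‖ + 1) / ‖x - a‖ := by positivity
  have h1 := hM _ ⟨_, ht, rfl⟩
  have h2 := norm_sub_le (x + ((M + ‖x‖ + 1) / ‖x - a‖) • (x - a)) x
  rw [add_sub_cancel_left, norm_smul, Real.norm_of_nonneg ht, div_mul_cancel₀ _ hn.ne'] at h2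
  linarith

theorem inside_frontier (hA : IsPlanarConvexBody A) : inside (frontier A) = interior A := by
  have hcl := hA.2.1.isClosed
  ext x
  constructor
  · rintro ⟨hx, hb⟩
    by_contra hxi
    refine not_isBounded_connectedComponentIn_compl_frontier hA (fun hxA => hx ?_) hb
    exact ⟨subset_closure hxA, hxi⟩
  · intro hx
    have hxf : x ∈ (frontier A)ᶜ := fun h => h.2 hx
    refine ⟨hxf, hA.2.1.isBounded.subset (Subset.trans ?_ interior_subset)⟩
    refine isPreconnected_connectedComponentIn.subset_left_of_subset_union isOpen_interior
      hcl.isOpen_compl (disjoint_compl_right.mono_left interior_subset) ?_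
      ⟨x, mem_connectedComponentIn hxf, hx⟩
    intro y hy
    by_cases hyA : y ∈ A
    · refine Or.inl (by_contra fun hyi => connectedComponentIn_subset _ _ hy ?_)
      exact ⟨subset_closure hyA, hyi⟩
    · exact Or.inr hyA

theorem IsPlanarConvexBody.isClosedJordanRegion (hA : IsPlanarConvexBody A) :
    IsClosedJordanRegion A := by
  refine ⟨frontier A, hA.isJordanCurve_frontier, ?_⟩
  rw [inside_frontier hA, union_comm, ← closure_eq_interior_union_frontier,
    hA.2.1.isClosed.closure_eq]

end Jordan

/-! ### Homothetic bodies and common boundary points -/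

section Homothetic

variable {A B : Set Plane}

theorem Homothetic.symm (h : Homothetic A B) : Homothetic B A := by
  obtain ⟨r, hr, c, rfl⟩ := h
  refine ⟨r⁻¹, inv_pos.2 hr, -(r⁻¹ • c), ?_⟩
  simp [image_image, smul_smul, hr.ne']

theorem Homothetic.trans {C : Set Plane} (h : Homothetic A B) (h' : Homothetic B C) :
    Homothetic A C := by
  obtain ⟨r, hr, c, rfl⟩ := h
  obtain ⟨s, hs, d, rfl⟩ := h'
  refine ⟨s * r, mul_pos hs hr, s • c + d, ?_⟩
  simp [image_image, smul_smul, add_assoc]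

/-- A homothety of the plane as a homeomorphism. -/
noncomputable def homothetyHomeomorph (r : ℝ) (hr : r ≠ 0) (c : Plane) : Plane ≃ₜ Plane :=
  (Homeomorph.smulOfNeZero r hr).trans (Homeomorph.addRight c)

theorem coe_homothetyHomeomorph (r : ℝ) (hr : r ≠ 0) (c : Plane) :
    ⇑(homothetyHomeomorph r hr c) = fun x => r • x + c := rfl

theorem IsPlanarConvexBody.of_homothetic (hA : IsPlanarConvexBody A) (h : Homothetic A B) :
    IsPlanarConvexBody B := by
  obtain ⟨r, hr, c, rfl⟩ := h
  refine ⟨?_, hA.2.1.image (by fun_prop), ?_⟩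
  · have himage : (fun x => r • x + c) '' A = (fun x => c + x) '' (r • A) := by
      rw [← image_smul, image_image]
      simp only [add_comm]
    rw [himage]
    exact (hA.1.smul r).translate c
  · rw [← coe_homothetyHomeomorph r hr.ne', ← Homeomorph.image_interior]
    exact hA.2.2.image _

theorem IsConvexPolygon.isPlanarConvexBody (hA : IsConvexPolygon A) : IsPlanarConvexBody A := by
  obtain ⟨⟨S, hS, rfl⟩, hint⟩ := hA
  exact ⟨convex_convexHull ℝ S, hS.isCompact_convexHull ℝ, hint⟩

theorem IsPlanarConvexBody.isArcConnected_diff (hA : IsPlanarConvexBody A)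
    (h : Homothetic A B) : IsArcConnected (A \ B) := by
  have hB := hA.of_homothetic h
  obtain ⟨r, hr, c, rfl⟩ := h
  intro x hx y hy
  exact joinedIn_diff_of_isPreconnected hA.2.1 hA.1 (hA.2.2.mono interior_subset) hB.2.1 hB.1
    (hB.2.2.mono interior_subset)
    (isPreconnected_supportFun_lt one_lt_rank_plane hA.2.1 hA.2.2 hr.le c) hx hy

/-- Homothetic planar convex bodies always form an arrangement of pseudodisks, even if their
boundaries share segments. -/
theorem isPseudodiskArrangement_of_homothetic {ι : Type*} {A : ι → Set Plane}
    (hA : ∀ i, IsPlanarConvexBody (A i)) (h : ∀ i j, Homothetic (A i) (A j)) :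
    IsPseudodiskArrangement A :=
  ⟨fun i => (hA i).isClosedJordanRegion, fun i j _ =>
    ⟨(hA i).isArcConnected_diff (h i j), (hA j).isArcConnected_diff (h j i)⟩⟩

theorem exists_smul_add_smul_add_smul_eq_of_not_collinear {x y z : Plane}
    (h : ¬ Collinear ℝ {x, y, z}) (v : Plane) (m : ℝ) :
    ∃ a b c : ℝ, a + b + c = m ∧ v = a • x + b • y + c • z := by
  have hi := (affineIndependent_iff_not_collinear_set (k := ℝ)).2 h
  have htop := hi.affineSpan_eq_top_iff_card_eq_finrank_add_one.2 (by simp)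
  -- Adding `(1 - m) • x` turns total weight `m` into barycentric coordinates of total weight 1.
  obtain ⟨w, hw, hv⟩ := eq_affineCombination_of_mem_affineSpan_of_fintype (k := ℝ)
    (htop.symm ▸ AffineSubspace.mem_top ℝ Plane (v + (1 - m) • x))
  rw [Finset.affineCombination_eq_linear_combination _ _ _ hw] at hv
  simp only [Fin.sum_univ_three, Matrix.cons_val] at hw hv
  refine ⟨w 0 - (1 - m), w 1, w 2, by linarith, ?_⟩
  rw [eq_sub_of_add_eq hv]
  module

theorem infinite_segment {x y : Plane} (h : x ≠ y) : (segment ℝ x y).Infinite := by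
  rw [segment_eq_image_lineMap]
  exact (Icc_infinite zero_lt_one).image (AffineMap.lineMap_injective ℝ h).injOn

theorem encard_frontier_inter_le_two (hA : IsPlanarConvexBody A) (h : Homothetic A B)
    (hfin : (frontier A ∩ frontier B).Finite) : (frontier A ∩ frontier B).encard ≤ 2 := by
  by_contra! hlt
  rw [← hfin.cast_ncard_eq, ← Nat.cast_two, Nat.cast_lt, two_lt_ncard_iff hfin] at hlt
  obtain ⟨x, y, z, hx, hy, hz, hxy, hxz, hyz⟩ := hlt
  have hAcl := hA.2.1.isClosed
  have hB := hA.of_homothetic h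
  obtain ⟨s, hs, e, hAB⟩ := h.symm
  have hfr : ∀ v, s • v + e ∈ frontier A ↔ v ∈ frontier B := by
    intro v
    rw [hAB, ← coe_homothetyHomeomorph s hs.ne', ← Homeomorph.image_frontier]
    exact (homothetyHomeomorph s hs.ne' e).injective.mem_set_image
  have hcol : ¬ Collinear ℝ {x, y, z} := by
    intro hc
    have hno : ∀ {u v w : Plane}, u ∈ frontier A ∩ frontier B → v ∈ frontier A ∩ frontier B →
        w ∈ frontier A ∩ frontier B → u ≠ v → v ≠ w → u ≠ w → ¬ Wbtw ℝ u v w := by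
      intro u v w hu hv hw huv hvw huw hb
      refine infinite_segment huw (hfin.subset (subset_inter ?_ ?_))
      · exact segment_subset_frontier_of_wbtw hA.1 hA.2.2 (hAcl.frontier_subset hu.1) hv.1
          (hAcl.frontier_subset hw.1) huv hvw hb
      · exact segment_subset_frontier_of_wbtw hB.1 hB.2.2 (hB.2.1.isClosed.frontier_subset hu.2)
          hv.2 (hB.2.1.isClosed.frontier_subset hw.2) huv hvw hb
    rcases hc.wbtw_or_wbtw_or_wbtw with hb | hb | hb
    · exact hno hx hy hz hxy hyz hxz hb
    · exact hno hy hz hx hyz hxz.symm hxy.symm hb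
    · exact hno hz hx hy hxz.symm hxy hyz.symm hb
  obtain ⟨a, b, c, habc, he⟩ := exists_smul_add_smul_add_smul_eq_of_not_collinear hcol e (1 - s)
  -- The displacement `s u + e - u` equals `β (v - u) + γ (w - u)`. If it pointed into the cone at
  -- `u`, or into its opposite, the triangle lemma would place the segment from `u` to `v` in both
  -- boundaries.
  have key : ∀ {u v w : Plane} {α β γ : ℝ}, u ∈ frontier A ∩ frontier B →
      v ∈ frontier A ∩ frontier B → w ∈ frontier A ∩ frontier B → u ≠ v → α + β + γ = 1 - s →
      e = α • u + β • v + γ • w → ¬ (0 < β ∧ 0 ≤ γ) ∧ ¬ (β < 0 ∧ γ ≤ 0) := by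
    intro u v w α β γ hu hv hw huv hsum he
    have hseg : ¬ (segment ℝ u v ⊆ frontier A ∧
        segment ℝ (s • u + e) (s • v + e) ⊆ frontier A) := by
      rintro ⟨h1, h2⟩
      refine infinite_segment huv (hfin.subset (subset_inter h1 fun p hp => (hfr p).1 (h2 ?_)))
      obtain ⟨k, l, hk, hl, hkl, rfl⟩ := hp
      refine ⟨k, l, hk, hl, hkl, ?_⟩
      obtain rfl : k = 1 - l := by linarith
      module
    have hmem := fun {p} (hp : p ∈ frontier A ∩ frontier B) => hAcl.frontier_subset hp.1
    have hmem' := fun {p} (hp : p ∈ frontier A ∩ frontier B) =>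
      hAcl.frontier_subset ((hfr p).2 hp.2)
    obtain rfl : α = 1 - s - β - γ := by linarith
    constructor
    · rintro ⟨hβ, hγ⟩
      refine hseg (segment_subset_frontier_of_homothetic_triangles hA.1 hA.2.2 (hmem hu) (hmem hv)
        (hmem' hu) (hmem' hv) (hmem' hw) ((hfr u).2 hu.2) hs (z := w) (by module) (by module) ?_
        hβ hγ)
      rw [he]
      module
    -- The two triangles exchange roles, with ratio `s⁻¹`.
    · rintro ⟨hβ, hγ⟩
      refine hseg (segment_subset_frontier_of_homothetic_triangles hA.1 hA.2.2 (hmem' hu)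
        (hmem' hv) (hmem hu) (hmem hv) (hmem hw) hu.1 (inv_pos.2 hs) (z := s • w + e)
        (a := -β / s) (b := -γ / s) ?_ ?_ ?_ (div_pos (neg_pos.2 hβ) hs)
        (div_nonneg (neg_nonneg.2 hγ) hs.le)).symm
      · match_scalars <;> field_simp
        ring
      · match_scalars <;> field_simp
        ring
      · rw [he]
        match_scalars <;> field_simp <;> ring
  have k1 := key hx hy hz hxy habc he
  have k2 := key hx hz hy hxz (by linarith) (he.trans (by module) : e = a • x + c • z + b • y)
  have k3 := key hy hx hz hxy.symm (by linarith)
    (he.trans (by module) : e = b • y + a • x + c • z)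
  have k4 := key hy hz hx hyz (by linarith) (he.trans (by module) : e = b • y + c • z + a • x)
  have k5 := key hz hx hy hxz.symm (by linarith)
    (he.trans (by module) : e = c • z + a • x + b • y)
  have k6 := key hz hy hx hyz.symm (by linarith)
    (he.trans (by module) : e = c • z + b • y + a • x)
  -- Any two of the coefficients have strictly opposite signs or both vanish; three reals can only
  -- do this by all being zero.
  have hzero : a = 0 ∧ b = 0 ∧ c = 0 := by grind
  obtain ⟨rfl, rfl, rfl⟩ := hzero
  obtain rfl : s = 1 := by linarith
  have hEq : A = B := by simpa [he] using hAB
  rw [hEq, inter_self] at hfin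
  exact hB.infinite_frontier hfin

end Homothetic

end PseudodiskPaper

theorem mainTheorem12 :
    (∀ {ι : Type*} (A : ι → Set PseudodiskPaper.Plane),
      (∀ i, PseudodiskPaper.IsPlanarConvexBody (A i)) →
      (∀ i j, PseudodiskPaper.Homothetic (A i) (A j)) →
      PseudodiskPaper.InGeneralPosition A →
      PseudodiskPaper.IsPseudodiskArrangement A ∧
        ∀ i j, i ≠ j → (frontier (A i) ∩ frontier (A j)).encard ≤ 2) ∧
    (∀ P : Set PseudodiskPaper.Plane, PseudodiskPaper.IsConvexPolygon P →
      ∀ {V : Type*} (G : SimpleGraph V),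
        PseudodiskPaper.IsHomGraph P G → PseudodiskPaper.IsPseudodiskGraph G) := by
  refine ⟨fun A hA h hgen => ⟨PseudodiskPaper.isPseudodiskArrangement_of_homothetic hA h,
    fun i j hij => PseudodiskPaper.encard_frontier_inter_le_two (hA i) (h i j) (hgen i j hij)⟩, ?_⟩
  -- The given representation itself is an arrangement of pseudodisks.
  rintro P hP V G ⟨R, hR, h⟩
  exact ⟨R, hR, PseudodiskPaper.isPseudodiskArrangement_of_homothetic
    (fun v => hP.isPlanarConvexBody.of_homothetic (h v)) fun u v => (h u).symm.trans (h v)⟩
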